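/- Let $N$ be a connected smooth $m$-dimensional manifold and let $\{N,\gamma,\ell,\ell^{(2)}\}$ be metric hypersurface data on it: $\gamma$ is a smooth symmetric two-covariant tensor field, $\ell$ a smooth one-form and $\ell^{(2)}$ a smooth function such that at every $p\in N$ the symmetric bilinear form $$\mathcal A|_p((W,a),(Z,b)) = \gamma(W,Z)+a\,\ell(Z)+b\,\ell(W)+ab\,\ell^{(2)}$$ on $T_pN\times\mathbb R$ is non-degenerate. Let $(n,n^{(2)})$ be the vector field and the function determined by $\gamma(n,\cdot)+n^{(2)}\ell=0$ and $\ell(n)+n^{(2)}\ell^{(2)}=1$, and put $U=\frac12\mathcal L_n\gamma+\frac12(\ell\otimes dn^{(2)}+dn^{(2)}\otimes\ell)$. The metric hypersurface connection $\overset{\circ}{\nabla}$ is the torsion-free connection on $N$ satisfying, for all vector fields $X,Z,W$, $$(\overset{\circ}{\nabla}_X\gamma)(Z,W)=-U(X,Z)\,\ell(W)-U(X,W)\,\ell(Z),\qquad (\overset{\circ}{\nabla}_X\ell)(Z)+(\overset{\circ}{\nabla}_Z\ell)(X)=-2\,\ell^{(2)}\,U(X,Z).$$ Let $p\in N$ be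 a non-null point (i.e. the radical of $\gamma|_p$ is zero) and let $U_p$ be an open neighbourhood of $p$ all of whose points are non-null, so that $\gamma$ is a (pseudo-Riemannian) metric on $U_p$. Then the connection $\overset{\circ}{\nabla}$ on $N$ and the Levi-Civita connection $\nabla^{(\gamma)}$ of $\gamma$ on $U_p$ exist, the function $\ell^{(2)}-\gamma(\ell^\sharp,\ell^\sharp)$ vanishes nowhere on $U_p$, and on $U_p$ $$\overset{\circ}{\nabla}=\nabla^{(\gamma)}-\frac{1}{2\left(\ell^{(2)}-\gamma(\ell^\sharp,\ell^\sharp)\right)}\;\ell^\sharp\otimes\mathcal L_{\ell^\sharp}\gamma ,$$ that is, for all smooth vector fields $X,Z$ on $U_p$, $$\overset{\circ}{\nabla}_XZ=\nabla^{(\gamma)}_XZ-\frac{(\mathcal L_{\ell^\sharp}\gamma)(X,Z)}{2\left(\ell^{(2)}-\gamma(\ell^\sharp,\ell^\sharp)\right)}\,\ell^\sharp ,$$ where $\ell^\sharp=\gamma^\sharp(\ell,\cdot)$ is the vector field on $U_p$ with $\gamma(\ell^\sharp,\cdot)=\ell$. -/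

import Mathlib

open Set Bundle
open scoped Manifold ContDiff

noncomputable section

namespace HypersurfaceData

section

variable {m : ℕ} {N : Type*} [TopologicalSpace N] [ChartedSpace (EuclideanSpace ℝ (Fin m)) N]

instance (x : N) : FiniteDimensional ℝ (TangentSpace (𝓡 m) x) :=
  inferInstanceAs (FiniteDimensional ℝ (EuclideanSpace ℝ (Fin m)))

variable (m N) in
/-- Vector fields, not necessarily smooth. -/
abbrev VField : Type _ := Π x : N, TangentSpace (𝓡 m) x

variable (m N) in
/-- One-form fields, not necessarily smooth. -/
abbrev OneForm : Type _ := Π x : N, TangentSpace (𝓡 m) x →L[ℝ] ℝ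

variable (m N) in
/-- Two-covariant tensor fields, not necessarily smooth. -/
abbrev CovTensor₂ : Type _ :=
  Π x : N, TangentSpace (𝓡 m) x →L[ℝ] TangentSpace (𝓡 m) x →L[ℝ] ℝ

variable (m N) in
/-- Operations `∇` taking a vector field `Z` to the endomorphism field `X ↦ ∇_X Z`.
As in Mathlib, `∇_X Z` at the point `x` is written `cov Z x (X x)`. -/
abbrev PreConnection : Type _ :=
  VField m N → Π x : N, TangentSpace (𝓡 m) x →L[ℝ] TangentSpace (𝓡 m) x

/-- The vector field `X` is smooth on the set `s`. -/
def SmoothFieldOn [IsManifold (𝓡 m) ∞ N] (X : VField m N) (s : Set N) : Prop :=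
  ContMDiffOn (𝓡 m) ((𝓡 m).prod 𝓘(ℝ, EuclideanSpace ℝ (Fin m))) ∞
    (fun x ↦ TotalSpace.mk' (EuclideanSpace ℝ (Fin m)) x (X x)) s

/-- The one-form field `α` is smooth. -/
def SmoothOneForm [IsManifold (𝓡 m) ∞ N] (α : OneForm m N) : Prop :=
  ContMDiff (𝓡 m) ((𝓡 m).prod 𝓘(ℝ, EuclideanSpace ℝ (Fin m) →L[ℝ] ℝ)) ∞
    (fun x ↦ TotalSpace.mk' (EuclideanSpace ℝ (Fin m) →L[ℝ] ℝ)
      (E := fun x : N ↦ TangentSpace (𝓡 m) x →L[ℝ] ℝ) x (α x))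

/-- The two-covariant tensor field `T` is smooth. -/
def SmoothCovTensor₂ [IsManifold (𝓡 m) ∞ N] (T : CovTensor₂ m N) : Prop :=
  ContMDiff (𝓡 m)
    ((𝓡 m).prod 𝓘(ℝ, EuclideanSpace ℝ (Fin m) →L[ℝ] EuclideanSpace ℝ (Fin m) →L[ℝ] ℝ)) ∞
    (fun x ↦ TotalSpace.mk' (EuclideanSpace ℝ (Fin m) →L[ℝ] EuclideanSpace ℝ (Fin m) →L[ℝ] ℝ)
      (E := fun x : N ↦ TangentSpace (𝓡 m) x →L[ℝ] TangentSpace (𝓡 m) x →L[ℝ] ℝ) x (T x))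

/-- The derivative `X(f)` of a function along a vector field. -/
def dirDeriv (X : VField m N) (f : N → ℝ) (x : N) : ℝ :=
  mvfderiv (𝓡 m) f x (X x)

/-- The Lie derivative of a two-covariant tensor,
`(𝓛_V T)(Z, W) = V(T(Z, W)) - T([V, Z], W) - T(Z, [V, W])`. -/
def lieDeriv₂ (V : VField m N) (T : CovTensor₂ m N) (Z W : VField m N) (x : N) : ℝ :=
  dirDeriv V (fun y ↦ T y (Z y) (W y)) x
    - T x (VectorField.mlieBracket (𝓡 m) V Z x) (W x)
    - T x (Z x) (VectorField.mlieBracket (𝓡 m) V W x)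

/-- `(∇_X T)(Z, W) = X(T(Z, W)) - T(∇_X Z, W) - T(Z, ∇_X W)`. -/
def covDeriv₂ (cov : PreConnection m N) (T : CovTensor₂ m N) (X Z W : VField m N) (x : N) : ℝ :=
  dirDeriv X (fun y ↦ T y (Z y) (W y)) x
    - T x (cov Z x (X x)) (W x) - T x (Z x) (cov W x (X x))

/-- `(∇_X α)(Z) = X(α(Z)) - α(∇_X Z)`. -/
def covDeriv₁ (cov : PreConnection m N) (α : OneForm m N) (X Z : VField m N) (x : N) : ℝ :=
  dirDeriv X (fun y ↦ α y (Z y)) x - α x (cov Z x (X x))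

/-- `∇_X Z - ∇_Z X = [X, Z]` on the set `s`. -/
def TorsionFreeOn [IsManifold (𝓡 m) ∞ N] (cov : PreConnection m N) (s : Set N) : Prop :=
  ∀ X Z : VField m N, SmoothFieldOn X s → SmoothFieldOn Z s → ∀ x ∈ s,
    cov Z x (X x) - cov X x (Z x) = VectorField.mlieBracket (𝓡 m) X Z x

/-- `cov` is, on the open set `s`, the Levi-Civita connection of `g` (a symmetric tensor which
is non-degenerate on `s`, of any signature): the torsion-free connection with `∇ g = 0`. -/
structure IsLeviCivitaOn [IsManifold (𝓡 m) ∞ N] (g : CovTensor₂ m N) (s : Set N)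
    (cov : PreConnection m N) : Prop where
  isConnection : IsCovariantDerivativeOn (EuclideanSpace ℝ (Fin m)) cov s
  torsionFree : TorsionFreeOn cov s
  metric : ∀ X Z W : VField m N, SmoothFieldOn X s → SmoothFieldOn Z s → SmoothFieldOn W s →
    ∀ x ∈ s, covDeriv₂ cov g X Z W x = 0

/-- The symmetric bilinear form `𝒜|ₓ` on `T_x N × ℝ`,
`𝒜((W, a), (Z, b)) = γ(W, Z) + a ℓ(Z) + b ℓ(W) + a b ℓ⁽²⁾`. -/
def ambientForm (γ : CovTensor₂ m N) (ℓ : OneForm m N) (ℓ₂ : N → ℝ) (x : N) :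
    LinearMap.BilinForm ℝ (TangentSpace (𝓡 m) x × ℝ) :=
  LinearMap.mk₂ ℝ
    (fun V V' ↦ γ x V.1 V'.1 + V.2 * ℓ x V'.1 + V'.2 * ℓ x V.1 + V.2 * V'.2 * ℓ₂ x)
    (fun _ _ _ ↦ by simp; ring) (fun _ _ _ ↦ by simp; ring)
    (fun _ _ _ ↦ by simp; ring) (fun _ _ _ ↦ by simp; ring)

end

/-- Metric hypersurface data `{N, γ, ℓ, ℓ⁽²⁾}` on an `m`-dimensional smooth manifold `N`. -/
structure MetricHypersurfaceData (m : ℕ) (N : Type*) [TopologicalSpace N]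
    [ChartedSpace (EuclideanSpace ℝ (Fin m)) N] [IsManifold (𝓡 m) ∞ N] where
  γ : CovTensor₂ m N
  ℓ : OneForm m N
  ℓ₂ : N → ℝ
  smooth_γ : SmoothCovTensor₂ γ
  smooth_ℓ : SmoothOneForm ℓ
  smooth_ℓ₂ : ContMDiff (𝓡 m) 𝓘(ℝ, ℝ) ∞ ℓ₂
  symm_γ : ∀ (x : N) (V W : TangentSpace (𝓡 m) x), γ x V W = γ x W V
  nondegenerate : ∀ x : N, (ambientForm γ ℓ ℓ₂ x).Nondegenerate

namespace MetricHypersurfaceData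

variable {m : ℕ} {N : Type*} [TopologicalSpace N] [ChartedSpace (EuclideanSpace ℝ (Fin m)) N]
  [IsManifold (𝓡 m) ∞ N] (D : MetricHypersurfaceData m N)

/-- The point `x` is non-null: the radical of `γ|ₓ` is zero. -/
def IsNonNull (x : N) : Prop :=
  ∀ X : TangentSpace (𝓡 m) x, (∀ W : TangentSpace (𝓡 m) x, D.γ x X W = 0) → X = 0

/-- The vector `(n, n⁽²⁾) = 𝒜♯((0, 1), ·)` of `T_x N × ℝ`, that is, the unique `V` such that
`𝒜(V, (Z, b)) = b` for all `(Z, b)`. -/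
def normalPair (x : N) : TangentSpace (𝓡 m) x × ℝ :=
  (LinearMap.BilinForm.toDual (ambientForm D.γ D.ℓ D.ℓ₂ x) (D.nondegenerate x)).symm
    (LinearMap.snd ℝ (TangentSpace (𝓡 m) x) ℝ)

/-- The vector field `n`. -/
def n : VField m N := fun x ↦ (D.normalPair x).1

/-- The function `n⁽²⁾`. -/
def n₂ : N → ℝ := fun x ↦ (D.normalPair x).2

/-- The tensor `U = ½ 𝓛_n γ + ℓ ⊗ₛ dn⁽²⁾`, evaluated on vector fields. -/
def U (X Z : VField m N) (x : N) : ℝ :=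
  (1 / 2) * lieDeriv₂ D.n D.γ X Z x
    + (1 / 2) * (D.ℓ x (X x) * dirDeriv Z D.n₂ x + dirDeriv X D.n₂ x * D.ℓ x (Z x))

/-- `cov` is the metric hypersurface connection of the data: the torsion-free connection with
`(∇_X γ)(Z, W) = - U(X, Z) ℓ(W) - U(X, W) ℓ(Z)` and
`(∇_X ℓ)(Z) + (∇_Z ℓ)(X) = - 2 ℓ⁽²⁾ U(X, Z)`. -/
structure IsMetricHypersurfaceConnection (cov : PreConnection m N) : Prop where
  isConnection : IsCovariantDerivativeOn (EuclideanSpace ℝ (Fin m)) cov univ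
  torsionFree : TorsionFreeOn cov univ
  deriv_γ : ∀ X Z W : VField m N,
    SmoothFieldOn X univ → SmoothFieldOn Z univ → SmoothFieldOn W univ → ∀ x : N,
    covDeriv₂ cov D.γ X Z W x = - D.U X Z x * D.ℓ x (W x) - D.U X W x * D.ℓ x (Z x)
  deriv_ℓ : ∀ X Z : VField m N, SmoothFieldOn X univ → SmoothFieldOn Z univ → ∀ x : N,
    covDeriv₁ cov D.ℓ X Z x + covDeriv₁ cov D.ℓ Z X x = - 2 * D.ℓ₂ x * D.U X Z x

/-- The vector field `ℓ♯ = γ♯(ℓ, ·)`, where `γ♯` is the inverse of `γ`. Meaningful at non-null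
points only, where `γ|ₓ : T_x N → T_x^* N` is invertible and `ℓ♯` is the vector with
`γ(ℓ♯, ·) = ℓ`. -/
def ℓsharp : VField m N := fun x ↦ (D.γ x).inverse (D.ℓ x)

end MetricHypersurfaceData

end HypersurfaceData

end

/-! Everything comes from one Koszul argument for the non-degenerate form `𝒜`. Torsion-freeness and
the equation for `∇γ` force `2γ(∇_X Z, W) = K(X, Z, W) + 2U(X, Z)ℓ(W)`, where `K` is the usual
Koszul expression; the equation for `∇ℓ` similarly forces `2ℓ(∇_X Z) = K₁(X, Z) + 2ℓ⁽²⁾U(X, Z)`.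
Together they say that the pair `(∇_X Z, -U(X, Z))` is the `𝒜`-dual of `(W, b) ↦ ½K(X, Z, W) +
½bK₁(X, Z)`.

For existence, this dual pair is taken as the definition (`koszulPair`). Its first component is a
connection, and pairing with `(n, n⁽²⁾)` shows that its second component is `-U` (`koszulPair_snd`),
so the required equations hold.

At non-null points `γ` is invertible and `2γ(∇^γ_X Z, W) = K(X, Z, W)`, hence `∇_X Z = ∇^γ_X Z +
U(X, Z)ℓ♯` (`eq_leviCivita_add`). This also constructs `∇^γ`, as `∇ - U ⊗ ℓ♯`. Finally `n = -n⁽²⁾ℓ♯`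
and `n⁽²⁾(ℓ⁽²⁾ - γ(ℓ♯, ℓ♯)) = 1`; inserting this in `U`, the `dn⁽²⁾` terms cancel and `U = -½n⁽²⁾
𝓛_{ℓ♯}γ` remains (`U_eq_lieDeriv₂_ℓsharp`). -/

noncomputable section

namespace HypersurfaceData

/-! ### Directional derivatives, differentiability and extension of vector fields -/

section Basic

open VectorField

variable {m : ℕ} {N : Type*} [TopologicalSpace N] [ChartedSpace (EuclideanSpace ℝ (Fin m)) N]

/-- The function `f` is differentiable at `x`. -/
abbrev DiffFunAt (f : N → ℝ) (x : N) : Prop := MDifferentiableAt (𝓡 m) 𝓘(ℝ, ℝ) f x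

section dirDeriv

variable {X Y : VField m N} {f g : N → ℝ} {x : N}

lemma dirDeriv_congr (h : X x = Y x) (hfg : f =ᶠ[nhds x] g) :
    dirDeriv X f x = dirDeriv Y g x := by
  simp only [dirDeriv, mvfderiv, hfg.mfderiv_eq, h]
  rw [hfg.self_of_nhds]

lemma dirDeriv_mul (hf : DiffFunAt (m := m) f x) (hg : DiffFunAt (m := m) g x) :
    dirDeriv X (fun y ↦ f y * g y) x = f x * dirDeriv X g x + g x * dirDeriv X f x := by
  simp [dirDeriv, mvfderiv_fun_mul hf hg]

lemma dirDeriv_add (hf : DiffFunAt (m := m) f x) (hg : DiffFunAt (m := m) g x) :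
    dirDeriv X (fun y ↦ f y + g y) x = dirDeriv X f x + dirDeriv X g x := by
  simp [dirDeriv, mvfderiv_fun_add hf hg]

lemma dirDeriv_neg : dirDeriv X (fun y ↦ - f y) x = - dirDeriv X f x := by
  simp [dirDeriv, mvfderiv_fun_neg]

lemma dirDeriv_add_left : dirDeriv (X + Y) f x = dirDeriv X f x + dirDeriv Y f x := by
  simp [dirDeriv]

lemma dirDeriv_smul_left : dirDeriv (g • X) f x = g x * dirDeriv X f x := by
  simp [dirDeriv]

end dirDeriv

variable [IsManifold (𝓡 m) ∞ N]

/-- The vector field `X` is differentiable at `x`. -/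
abbrev DiffFieldAt (X : VField m N) (x : N) : Prop :=
  MDifferentiableAt (𝓡 m) ((𝓡 m).prod 𝓘(ℝ, EuclideanSpace ℝ (Fin m)))
    (fun y ↦ TotalSpace.mk' (EuclideanSpace ℝ (Fin m)) y (X y)) x

lemma SmoothFieldOn.diffFieldAt {X : VField m N} {s : Set N} (hX : SmoothFieldOn X s)
    (hs : IsOpen s) {x : N} (hx : x ∈ s) : DiffFieldAt X x :=
  ((hX x hx).contMDiffAt (hs.mem_nhds hx)).mdifferentiableAt (by simp)

lemma SmoothOneForm.diffFunAt_apply {α : OneForm m N} (hα : SmoothOneForm α)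
    {Z : VField m N} {x : N} (hZ : DiffFieldAt Z x) :
    DiffFunAt (m := m) (fun y ↦ α y (Z y)) x := by
  have : MDifferentiableAt (𝓡 m) ((𝓡 m).prod 𝓘(ℝ))
      (fun y ↦ TotalSpace.mk' ℝ (E := Bundle.Trivial N ℝ) y (α y (Z y))) x :=
    MDifferentiableAt.clm_bundle_apply (F₁ := EuclideanSpace ℝ (Fin m))
      ((hα x).mdifferentiableAt (by simp)) hZ
  exact ((mdifferentiableAt_totalSpace _ _).1 this).2

lemma SmoothCovTensor₂.diffFunAt_apply {T : CovTensor₂ m N} (hT : SmoothCovTensor₂ T)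
    {Z W : VField m N} {x : N} (hZ : DiffFieldAt Z x) (hW : DiffFieldAt W x) :
    DiffFunAt (m := m) (fun y ↦ T y (Z y) (W y)) x := by
  have : MDifferentiableAt (𝓡 m) ((𝓡 m).prod 𝓘(ℝ))
      (fun y ↦ TotalSpace.mk' ℝ (E := Bundle.Trivial N ℝ) y (T y (Z y) (W y))) x :=
    MDifferentiableAt.clm_bundle_apply₂ (F₁ := EuclideanSpace ℝ (Fin m))
      (F₂ := EuclideanSpace ℝ (Fin m)) ((hT x).mdifferentiableAt (by simp)) hZ hW
  exact ((mdifferentiableAt_totalSpace _ _).1 this).2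

/-- A vector field that is smooth near `x` agrees near `x` with a globally smooth one. -/
lemma SmoothFieldOn.exists_global [T2Space N] {X : VField m N} {s : Set N}
    (hX : SmoothFieldOn X s) (hs : IsOpen s) {x : N} (hx : x ∈ s) :
    ∃ Y : VField m N, SmoothFieldOn Y univ ∧ ∀ᶠ y in nhds x, Y y = X y := by
  obtain ⟨ψ, -, hψ⟩ :=
    (SmoothBumpFunction.nhds_basis_tsupport (I := 𝓡 m) x).mem_iff.1 (hs.mem_nhds hx)
  refine ⟨(ψ : N → ℝ) • X, ?_, ?_⟩
  · exact (ContMDiffOn.smul_section_of_tsupport ψ.contMDiff.contMDiffOn hs hψ hX).contMDiffOn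
  · filter_upwards [ψ.eventuallyEq_one] with y hy
    rw [Pi.smul_apply', hy, Pi.one_apply, one_smul]

lemma exists_smoothField_eq [T2Space N] {x : N} (v : TangentSpace (𝓡 m) x) :
    ∃ Y : VField m N, SmoothFieldOn Y univ ∧ Y x = v := by
  obtain ⟨s, hs, h⟩ := FiberBundle.exists_contMDiffOn_extend (k := ∞) (𝓡 m)
    (EuclideanSpace ℝ (Fin m)) v
  obtain ⟨Y, hY, hYx⟩ := SmoothFieldOn.exists_global (s := interior s)
    (ContMDiffOn.mono h interior_subset) isOpen_interior (mem_interior_iff_mem_nhds.2 hs)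
  exact ⟨Y, hY, by simp [hYx.self_of_nhds]⟩

lemma DiffFieldAt.smul {X : VField m N} {f : N → ℝ} {x : N} (hf : DiffFunAt (m := m) f x)
    (hX : DiffFieldAt X x) : DiffFieldAt (f • X) x :=
  hf.smul_section hX

lemma DiffFieldAt.add {X Y : VField m N} {x : N} (hX : DiffFieldAt X x)
    (hY : DiffFieldAt Y x) : DiffFieldAt (X + Y) x :=
  mdifferentiableAt_add_section hX hY

lemma exists_diffFieldAt_eq {x : N} (v : TangentSpace (𝓡 m) x) :
    ∃ Y : VField m N, DiffFieldAt Y x ∧ Y x = v :=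
  ⟨FiberBundle.extend (EuclideanSpace ℝ (Fin m)) v,
    FiberBundle.mdifferentiableAt_extend (𝓡 m) (EuclideanSpace ℝ (Fin m)) v, by simp⟩

end Basic

/-! ### Algebra of the Koszul expressions -/

section Koszul

open VectorField

variable {m : ℕ} {N : Type*} [TopologicalSpace N] [ChartedSpace (EuclideanSpace ℝ (Fin m)) N]

/-- The right-hand side of the Koszul formula for `2 γ(∇_X Z, W)`. -/
def koszul (γ : CovTensor₂ m N) (X Z W : VField m N) (x : N) : ℝ :=
  dirDeriv X (fun y ↦ γ y (Z y) (W y)) x + dirDeriv Z (fun y ↦ γ y (X y) (W y)) x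
    - dirDeriv W (fun y ↦ γ y (X y) (Z y)) x + γ x (mlieBracket (𝓡 m) X Z x) (W x)
    - γ x (mlieBracket (𝓡 m) X W x) (Z x) - γ x (mlieBracket (𝓡 m) Z W x) (X x)

/-- The analogue of the Koszul formula for `2 ℓ(∇_X Z)`. -/
def koszul₁ (ℓ : OneForm m N) (X Z : VField m N) (x : N) : ℝ :=
  dirDeriv X (fun y ↦ ℓ y (Z y)) x + dirDeriv Z (fun y ↦ ℓ y (X y)) x
    + ℓ x (mlieBracket (𝓡 m) X Z x)

variable {γ : CovTensor₂ m N} {ℓ : OneForm m N} {V X X' Z Z' W W' : VField m N} {f : N → ℝ} {x : N}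

/-- The source of torsion-freeness for connections built from `koszul`. -/
lemma koszul_sub_swap
    (hs : ∀ (x : N) (V W : TangentSpace (𝓡 m) x), γ x V W = γ x W V) :
    koszul γ X Z W x - koszul γ Z X W x = 2 * γ x (mlieBracket (𝓡 m) X Z x) (W x) := by
  simp only [koszul, mlieBracket_swap_apply (V := Z) (W := X), fun y ↦ hs y (Z y) (X y), map_neg,
    neg_apply]
  ring

/-- The source of the formula for `∇γ`: for the Levi-Civita connection it is metric compatibility.
-/
lemma koszul_add_swap
    (hs : ∀ (x : N) (V W : TangentSpace (𝓡 m) x), γ x V W = γ x W V) :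
    koszul γ X Z W x + koszul γ X W Z x = 2 * dirDeriv X (fun y ↦ γ y (Z y) (W y)) x := by
  simp only [koszul, mlieBracket_swap_apply (V := W) (W := Z), fun y ↦ hs y (W y) (Z y), map_neg,
    neg_apply]
  ring

lemma koszul₁_sub_swap :
    koszul₁ ℓ X Z x - koszul₁ ℓ Z X x = 2 * ℓ x (mlieBracket (𝓡 m) X Z x) := by
  simp only [koszul₁, mlieBracket_swap_apply (V := Z) (W := X), map_neg]
  ring

variable [IsManifold (𝓡 m) ∞ N]

lemma mlieBracket_fun_smul_right (hf : DiffFunAt (m := m) f x) (hZ : DiffFieldAt Z x) :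
    mlieBracket (𝓡 m) V (f • Z) x = dirDeriv V f x • Z x + f x • mlieBracket (𝓡 m) V Z x :=
  mlieBracket_smul_right hf hZ

lemma mlieBracket_fun_smul_left (hf : DiffFunAt (m := m) f x) (hZ : DiffFieldAt Z x) :
    mlieBracket (𝓡 m) (f • Z) V x = - dirDeriv V f x • Z x + f x • mlieBracket (𝓡 m) Z V x :=
  mlieBracket_smul_left hf hZ

lemma koszul_add_left (hγ : SmoothCovTensor₂ γ) (hX : DiffFieldAt X x) (hX' : DiffFieldAt X' x)
    (hZ : DiffFieldAt Z x) (hW : DiffFieldAt W x) :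
    koszul γ (X + X') Z W x = koszul γ X Z W x + koszul γ X' Z W x := by
  simp only [koszul, dirDeriv_add_left, dirDeriv_add (hγ.diffFunAt_apply hX hZ) (hγ.diffFunAt_apply hX' hZ),
    dirDeriv_add (hγ.diffFunAt_apply hX hW) (hγ.diffFunAt_apply hX' hW),
    mlieBracket_add_left hX hX', Pi.add_apply, map_add,
    add_apply]
  ring

lemma koszul_add_mid (hγ : SmoothCovTensor₂ γ) (hX : DiffFieldAt X x)
    (hZ : DiffFieldAt Z x) (hZ' : DiffFieldAt Z' x) (hW : DiffFieldAt W x) :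
    koszul γ X (Z + Z') W x = koszul γ X Z W x + koszul γ X Z' W x := by
  simp only [koszul, dirDeriv_add_left, dirDeriv_add (hγ.diffFunAt_apply hZ hW) (hγ.diffFunAt_apply hZ' hW),
    dirDeriv_add (hγ.diffFunAt_apply hX hZ) (hγ.diffFunAt_apply hX hZ'),
    mlieBracket_add_left hZ hZ', mlieBracket_add_right hZ hZ',
    Pi.add_apply, map_add, add_apply]
  ring

lemma koszul_add_right (hγ : SmoothCovTensor₂ γ) (hX : DiffFieldAt X x)
    (hZ : DiffFieldAt Z x) (hW : DiffFieldAt W x) (hW' : DiffFieldAt W' x) :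
    koszul γ X Z (W + W') x = koszul γ X Z W x + koszul γ X Z W' x := by
  simp only [koszul, dirDeriv_add_left, dirDeriv_add (hγ.diffFunAt_apply hX hW) (hγ.diffFunAt_apply hX hW'),
    dirDeriv_add (hγ.diffFunAt_apply hZ hW) (hγ.diffFunAt_apply hZ hW'), mlieBracket_add_right hW hW',
    Pi.add_apply, map_add, add_apply]
  ring

lemma koszul_smul_left (hγ : SmoothCovTensor₂ γ) (hf : DiffFunAt (m := m) f x)
    (hX : DiffFieldAt X x) (hZ : DiffFieldAt Z x) (hW : DiffFieldAt W x) :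
    koszul γ (f • X) Z W x = f x * koszul γ X Z W x := by
  simp only [koszul, dirDeriv_smul_left, dirDeriv_mul hf (hγ.diffFunAt_apply hX hZ),
    dirDeriv_mul hf (hγ.diffFunAt_apply hX hW), mlieBracket_fun_smul_left hf hX, Pi.smul_apply', map_add,
    map_smul, add_apply, smul_apply, smul_eq_mul]
  ring

/-- The one slot that is not tensorial: the extra term becomes the Leibniz rule of the connection.
-/
lemma koszul_smul_mid (hγ : SmoothCovTensor₂ γ)
    (hs : ∀ (x : N) (V W : TangentSpace (𝓡 m) x), γ x V W = γ x W V)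
    (hf : DiffFunAt (m := m) f x)
    (hX : DiffFieldAt X x) (hZ : DiffFieldAt Z x) (hW : DiffFieldAt W x) :
    koszul γ X (f • Z) W x =
      f x * koszul γ X Z W x + 2 * dirDeriv X f x * γ x (Z x) (W x) := by
  simp only [koszul, dirDeriv_smul_left, dirDeriv_mul hf (hγ.diffFunAt_apply hZ hW),
    dirDeriv_mul hf (hγ.diffFunAt_apply hX hZ), mlieBracket_fun_smul_left hf hZ,
    mlieBracket_fun_smul_right hf hZ, Pi.smul_apply', map_add,
    map_smul, add_apply, smul_apply, smul_eq_mul,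
    hs x (Z x) (X x)]
  ring

lemma koszul_smul_right (hγ : SmoothCovTensor₂ γ)
    (hs : ∀ (x : N) (V W : TangentSpace (𝓡 m) x), γ x V W = γ x W V)
    (hf : DiffFunAt (m := m) f x)
    (hX : DiffFieldAt X x) (hZ : DiffFieldAt Z x) (hW : DiffFieldAt W x) :
    koszul γ X Z (f • W) x = f x * koszul γ X Z W x := by
  simp only [koszul, dirDeriv_smul_left, dirDeriv_mul hf (hγ.diffFunAt_apply hX hW),
    dirDeriv_mul hf (hγ.diffFunAt_apply hZ hW),
    mlieBracket_fun_smul_right hf hW, Pi.smul_apply', map_add,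
    map_smul, add_apply, smul_apply, smul_eq_mul,
    hs x (W x)]
  ring

lemma koszul₁_add_left (hℓ : SmoothOneForm ℓ) (hX : DiffFieldAt X x) (hX' : DiffFieldAt X' x) :
    koszul₁ ℓ (X + X') Z x = koszul₁ ℓ X Z x + koszul₁ ℓ X' Z x := by
  simp only [koszul₁, dirDeriv_add_left, Pi.add_apply,
    dirDeriv_add (hℓ.diffFunAt_apply hX) (hℓ.diffFunAt_apply hX'),
    mlieBracket_add_left hX hX', map_add]
  ring

lemma koszul₁_add_right (hℓ : SmoothOneForm ℓ) (hZ : DiffFieldAt Z x) (hZ' : DiffFieldAt Z' x) :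
    koszul₁ ℓ X (Z + Z') x = koszul₁ ℓ X Z x + koszul₁ ℓ X Z' x := by
  simp only [koszul₁, dirDeriv_add_left, Pi.add_apply,
    dirDeriv_add (hℓ.diffFunAt_apply hZ) (hℓ.diffFunAt_apply hZ'),
    mlieBracket_add_right hZ hZ', map_add]
  ring

lemma koszul₁_smul_left (hℓ : SmoothOneForm ℓ) (hf : DiffFunAt (m := m) f x)
    (hX : DiffFieldAt X x) :
    koszul₁ ℓ (f • X) Z x = f x * koszul₁ ℓ X Z x := by
  simp only [koszul₁, dirDeriv_smul_left, Pi.smul_apply', dirDeriv_mul hf (hℓ.diffFunAt_apply hX),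
    mlieBracket_fun_smul_left hf hX, map_add, map_smul, smul_eq_mul]
  ring

lemma koszul₁_smul_right (hℓ : SmoothOneForm ℓ) (hf : DiffFunAt (m := m) f x)
    (hZ : DiffFieldAt Z x) :
    koszul₁ ℓ X (f • Z) x = f x * koszul₁ ℓ X Z x + 2 * dirDeriv X f x * ℓ x (Z x) := by
  simp only [koszul₁, dirDeriv_smul_left, Pi.smul_apply', dirDeriv_mul hf (hℓ.diffFunAt_apply hZ),
    mlieBracket_fun_smul_right hf hZ, map_add, map_smul, smul_eq_mul]
  ring

end Koszul

/-! ### The ambient form as an operator on a model space -/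

section CoordinateForm

variable (E : Type*) [NormedAddCommGroup E] [NormedSpace ℝ E]

/-- The map `(V, a) ↦ (G(V, ·) + a l, l(V) + a c)` as a continuous linear map. -/
def ambientMap (G : E →L[ℝ] E →L[ℝ] ℝ) (l : E →L[ℝ] ℝ) (c : ℝ) :
    E × ℝ →L[ℝ] (E →L[ℝ] ℝ) × ℝ :=
  (ContinuousLinearMap.inl ℝ (E →L[ℝ] ℝ) ℝ).comp
      (G.comp (.fst ℝ E ℝ) + (ContinuousLinearMap.snd ℝ E ℝ).smulRight l)
    + (ContinuousLinearMap.inr ℝ (E →L[ℝ] ℝ) ℝ).comp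
      (l.comp (.fst ℝ E ℝ) + c • ContinuousLinearMap.snd ℝ E ℝ)

variable {E}

@[simp]
lemma ambientMap_apply (G : E →L[ℝ] E →L[ℝ] ℝ) (l : E →L[ℝ] ℝ) (c : ℝ) (V : E × ℝ) :
    ambientMap E G l c V = (G V.1 + V.2 • l, l V.1 + c * V.2) := by
  simp [ambientMap]

lemma mdifferentiableAt_ambientMap {m : ℕ} {N : Type*} [TopologicalSpace N]
    [ChartedSpace (EuclideanSpace ℝ (Fin m)) N] {G : N → E →L[ℝ] E →L[ℝ] ℝ} {l : N → E →L[ℝ] ℝ}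
    {c : N → ℝ} {x : N} (hG : MDifferentiableAt (𝓡 m) 𝓘(ℝ, E →L[ℝ] E →L[ℝ] ℝ) G x)
    (hl : MDifferentiableAt (𝓡 m) 𝓘(ℝ, E →L[ℝ] ℝ) l x)
    (hc : MDifferentiableAt (𝓡 m) 𝓘(ℝ, ℝ) c x) :
    MDifferentiableAt (𝓡 m) 𝓘(ℝ, E × ℝ →L[ℝ] (E →L[ℝ] ℝ) × ℝ)
      (fun y ↦ ambientMap E (G y) (l y) (c y)) x := by
  have h : MDifferentiableAt (𝓡 m) 𝓘(ℝ, E × ℝ →L[ℝ] E →L[ℝ] ℝ)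
      (fun y ↦ ContinuousLinearMap.smulRightL ℝ (E × ℝ) _ (ContinuousLinearMap.snd ℝ E ℝ) (l y))
      x :=
    (ContinuousLinearMap.differentiableAt _).mdifferentiableAt.comp x hl
  refine .add (mdifferentiableAt_const.clm_comp (.add (hG.clm_comp mdifferentiableAt_const) h))
    (mdifferentiableAt_const.clm_comp (.add (hl.clm_comp mdifferentiableAt_const)
      (hc.smul mdifferentiableAt_const)))

lemma isInvertible_ambientMap [FiniteDimensional ℝ E] {G : E →L[ℝ] E →L[ℝ] ℝ} {l : E →L[ℝ] ℝ}
    {c : ℝ} (h : ∀ V, ambientMap E G l c V = 0 → V = 0) : (ambientMap E G l c).IsInvertible := by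
  have hd : Module.finrank ℝ (E × ℝ) = Module.finrank ℝ ((E →L[ℝ] ℝ) × ℝ) := by
    have := (LinearMap.toContinuousLinearMap (𝕜 := ℝ) (E := E) (F' := ℝ)).finrank_eq
    rw [Module.finrank_prod, Module.finrank_prod, ← this, Subspace.dual_finrank_eq]
  have hi : Function.Injective (ambientMap E G l c).toLinearMap :=
    (injective_iff_map_eq_zero _).2 h
  exact ⟨((ambientMap E G l c).toLinearMap.linearEquivOfInjective hi hd).toContinuousLinearEquiv,
    rfl⟩

end CoordinateForm

/-! ### The normal pair and its differentiability -/

namespace MetricHypersurfaceData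

variable {m : ℕ} {N : Type*} [TopologicalSpace N] [ChartedSpace (EuclideanSpace ℝ (Fin m)) N]
  [IsManifold (𝓡 m) ∞ N] (D : MetricHypersurfaceData m N)

@[simp]
lemma ambientForm_apply (x : N) (V W : TangentSpace (𝓡 m) x × ℝ) :
    ambientForm D.γ D.ℓ D.ℓ₂ x V W =
      D.γ x V.1 W.1 + V.2 * D.ℓ x W.1 + W.2 * D.ℓ x V.1 + V.2 * W.2 * D.ℓ₂ x :=
  rfl

lemma ambientForm_ext {x : N} {V W : TangentSpace (𝓡 m) x × ℝ}
    (h : ∀ Y, ambientForm D.γ D.ℓ D.ℓ₂ x V Y = ambientForm D.γ D.ℓ D.ℓ₂ x W Y) : V = W := by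
  rw [← sub_eq_zero]
  refine (D.nondegenerate x).1 _ fun Y ↦ ?_
  rw [map_sub, LinearMap.sub_apply, h, sub_self]

lemma ambientForm_normalPair (x : N) (Y : TangentSpace (𝓡 m) x × ℝ) :
    ambientForm D.γ D.ℓ D.ℓ₂ x (D.normalPair x) Y = Y.2 := by
  rw [normalPair, LinearMap.BilinForm.apply_toDual_symm_apply]
  rfl

lemma γ_n (x : N) (W : TangentSpace (𝓡 m) x) : D.γ x (D.n x) W = - D.n₂ x * D.ℓ x W := by
  have := D.ambientForm_normalPair x (W, 0)
  simp only [ambientForm_apply] at this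
  simp only [n, n₂]
  linarith

lemma ℓ_n (x : N) : D.ℓ x (D.n x) = 1 - D.n₂ x * D.ℓ₂ x := by
  have := D.ambientForm_normalPair x (0, 1)
  simp only [ambientForm_apply, map_zero] at this
  simp only [n, n₂]
  linarith

/-- The normal pair `(n, n⁽²⁾)` is differentiable. -/
lemma normalPair_mdifferentiableAt (x₀ : N) :
    DiffFieldAt D.n x₀ ∧ DiffFunAt (m := m) D.n₂ x₀ := by
  set F := EuclideanSpace ℝ (Fin m)
  set e := trivializationAt F (TangentSpace (𝓡 m) : N → Type _) x₀
  have hx₀ : x₀ ∈ e.baseSet := FiberBundle.mem_baseSet_trivializationAt' x₀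
  obtain ⟨-, hγ⟩ := (contMDiffAt_hom_bundle _).1 (D.smooth_γ x₀)
  obtain ⟨-, hℓ⟩ := (contMDiffAt_hom_bundle
    (E₂ := Bundle.Trivial N ℝ) (F₂ := ℝ) _).1 (D.smooth_ℓ x₀)
  simp only at hγ hℓ
  replace hγ := hγ.mdifferentiableAt (by simp)
  replace hℓ := hℓ.mdifferentiableAt (by simp)
  have hℓ₂ := (D.smooth_ℓ₂ x₀).mdifferentiableAt (by simp)
  have hmem : ∀ᶠ y in nhds x₀, y ∈ e.baseSet := e.open_baseSet.mem_nhds hx₀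
  obtain ⟨γ', hγ', hγ'e⟩ : ∃ γ' : N → F →L[ℝ] F →L[ℝ] ℝ,
      MDifferentiableAt (𝓡 m) 𝓘(ℝ, F →L[ℝ] F →L[ℝ] ℝ) γ' x₀ ∧ ∀ y ∈ e.baseSet, ∀ v w,
        γ' y v w = D.γ y (e.symmL ℝ y v) (e.symmL ℝ y w) := by
    refine ⟨_, hγ, fun y hy v w ↦ ?_⟩
    rw [e.symmL_apply hy, e.symmL_apply hy]
    exact (inCoordinates_apply_eq₂ (𝕜 := ℝ) (F₃ := ℝ) (E₃ := Bundle.Trivial N ℝ) (ϕ := D.γ y)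
      hy hy (by simp)).trans (by simp; rfl)
  obtain ⟨ℓ', hℓ', hℓ'e⟩ : ∃ ℓ' : N → F →L[ℝ] ℝ,
      MDifferentiableAt (𝓡 m) 𝓘(ℝ, F →L[ℝ] ℝ) ℓ' x₀ ∧ ∀ y ∈ e.baseSet, ∀ v,
        ℓ' y v = D.ℓ y (e.symmL ℝ y v) := by
    refine ⟨_, hℓ, fun y hy v ↦ ?_⟩
    simp [ContinuousLinearMap.inCoordinates, e]
  -- In the trivialization the normal pair solves a linear system whose operator depends
  -- differentiably on the point. Non-degeneracy of `𝒜` makes the operator invertible, and inversion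
  -- is smooth at invertible operators.
  have hA : MDifferentiableAt (𝓡 m) 𝓘(ℝ, F × ℝ →L[ℝ] (F →L[ℝ] ℝ) × ℝ)
      (fun y ↦ ambientMap F (γ' y) (ℓ' y) (D.ℓ₂ y)) x₀ :=
    mdifferentiableAt_ambientMap hγ' hℓ' hℓ₂
  have hinv : ∀ y ∈ e.baseSet, (ambientMap F (γ' y) (ℓ' y) (D.ℓ₂ y)).IsInvertible := by
    intro y hy
    refine isInvertible_ambientMap fun V hV ↦ ?_
    simp only [ambientMap_apply, Prod.mk_eq_zero] at hV
    have h0 : ((e.symmL ℝ y V.1, V.2) : TangentSpace (𝓡 m) y × ℝ) = 0 := by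
      refine D.ambientForm_ext fun Y ↦ ?_
      have h1 := DFunLike.congr_fun hV.1 (e.continuousLinearMapAt ℝ y Y.1)
      simp only [add_apply, smul_apply, hγ'e y hy, hℓ'e y hy, e.symmL_continuousLinearMapAt hy,
        zero_apply, smul_eq_mul] at h1
      have h2 := hV.2
      rw [hℓ'e y hy] at h2
      simp only [ambientForm_apply, map_zero, LinearMap.zero_apply]
      linear_combination h1 + Y.2 * h2
    have h3 := (Prod.mk_eq_zero.1 h0).1
    have h4 := congrArg (e.continuousLinearMapAt ℝ y) h3
    rw [e.continuousLinearMapAt_symmL hy, map_zero] at h4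
    exact Prod.ext h4 (Prod.mk_eq_zero.1 h0).2
  have hsol : ∀ y ∈ e.baseSet,
      (ambientMap F (γ' y) (ℓ' y) (D.ℓ₂ y)).inverse (0, 1) =
        (e.continuousLinearMapAt ℝ y (D.n y), D.n₂ y) := by
    intro y hy
    rw [(hinv y hy).inverse_apply_eq, ambientMap_apply]
    refine Prod.ext ?_ ?_
    · ext v
      simp only [add_apply, smul_apply, hγ'e y hy, hℓ'e y hy, e.symmL_continuousLinearMapAt hy,
        D.γ_n, zero_apply, smul_eq_mul]
      ring
    · simp only [hℓ'e y hy, e.symmL_continuousLinearMapAt hy, D.ℓ_n]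
      ring
  have hd : MDifferentiableAt (𝓡 m) 𝓘(ℝ, F × ℝ)
      (fun y ↦ (e.continuousLinearMapAt ℝ y (D.n y), D.n₂ y)) x₀ := by
    have h1 : MDifferentiableAt (𝓡 m) 𝓘(ℝ, (F →L[ℝ] ℝ) × ℝ →L[ℝ] F × ℝ)
        (fun y ↦ (ambientMap F (γ' y) (ℓ' y) (D.ℓ₂ y)).inverse) x₀ :=
      (((hinv x₀ hx₀).contDiffAt_map_inverse (n := 1)).differentiableAt
        (by simp)).mdifferentiableAt.comp x₀ hA
    have h2 := h1.clm_apply (mdifferentiableAt_const (c := ((0, 1) : (F →L[ℝ] ℝ) × ℝ)))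
    refine h2.congr_of_eventuallyEq ?_
    filter_upwards [hmem] with y hy using (hsol y hy).symm
  have hd1 := (ContinuousLinearMap.fst ℝ F ℝ).differentiableAt.mdifferentiableAt.comp x₀ hd
  have hd2 := (ContinuousLinearMap.snd ℝ F ℝ).differentiableAt.mdifferentiableAt.comp x₀ hd
  refine ⟨?_, hd2⟩
  refine (mdifferentiableAt_section _ _).2 (hd1.congr_of_eventuallyEq ?_)
  filter_upwards [hmem] with y hy
  simp [e.coe_linearMapAt_of_mem hy]
  rfl

end MetricHypersurfaceData

/-! ### Existence of the metric hypersurface connection -/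

namespace MetricHypersurfaceData

open VectorField

variable {m : ℕ} {N : Type*} [TopologicalSpace N] [ChartedSpace (EuclideanSpace ℝ (Fin m)) N]
  [IsManifold (𝓡 m) ∞ N] (D : MetricHypersurfaceData m N)
  {X X' Z Z' W : VField m N} {f : N → ℝ} {x : N}

/-- Since `koszul` is tensorial in `W`, the right-hand side is a linear functional of `(W x, b)`,
which the non-degenerate form represents. -/
lemma exists_koszulPair (hX : DiffFieldAt X x) (hZ : DiffFieldAt Z x) :
    ∃ P : TangentSpace (𝓡 m) x × ℝ, ∀ (W : VField m N) (b : ℝ), DiffFieldAt W x →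
      ambientForm D.γ D.ℓ D.ℓ₂ x P (W x, b) =
        1 / 2 * koszul D.γ X Z W x + b * (1 / 2 * koszul₁ D.ℓ X Z x) := by
  have hT : TensorialAt (𝓡 m) (EuclideanSpace ℝ (Fin m)) (fun W ↦ koszul D.γ X Z W x) x :=
    { smul := fun hf hW ↦ koszul_smul_right D.smooth_γ D.symm_γ hf hX hZ hW
      add := fun hW hW' ↦ koszul_add_right D.smooth_γ hX hZ hW hW' }
  refine ⟨(LinearMap.BilinForm.toDual (ambientForm D.γ D.ℓ D.ℓ₂ x) (D.nondegenerate x)).symm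
    ((1 / 2 : ℝ) • (TensorialAt.mkHom _ x hT).toLinearMap ∘ₗ LinearMap.fst ℝ _ ℝ
      + (1 / 2 * koszul₁ D.ℓ X Z x) • LinearMap.snd ℝ _ ℝ), fun W b hW ↦ ?_⟩
  rw [LinearMap.BilinForm.apply_toDual_symm_apply]
  have := TensorialAt.mkHom_apply hT hW
  simp only [LinearMap.add_apply, LinearMap.smul_apply, LinearMap.comp_apply, LinearMap.fst_apply,
    LinearMap.snd_apply, ContinuousLinearMap.coe_coe, this, smul_eq_mul]
  ring

open Classical in
/-- The vector of `T_x N × ℝ` dual, with respect to the ambient form, to the right-hand sides of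
the Koszul formulas. Its components turn out to be `∇_X Z` and `- U(X, Z)`, where `∇` is the
metric hypersurface connection. -/
def koszulPair (X Z : VField m N) (x : N) : TangentSpace (𝓡 m) x × ℝ :=
  if h : DiffFieldAt X x ∧ DiffFieldAt Z x then (D.exists_koszulPair h.1 h.2).choose else 0

lemma ambientForm_koszulPair (hX : DiffFieldAt X x) (hZ : DiffFieldAt Z x)
    (hW : DiffFieldAt W x) (b : ℝ) :
    ambientForm D.γ D.ℓ D.ℓ₂ x (D.koszulPair X Z x) (W x, b) =
      1 / 2 * koszul D.γ X Z W x + b * (1 / 2 * koszul₁ D.ℓ X Z x) := by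
  rw [koszulPair, dif_pos ⟨hX, hZ⟩]
  exact (D.exists_koszulPair hX hZ).choose_spec W b hW

lemma ambientForm_ext_field {V V' : TangentSpace (𝓡 m) x × ℝ}
    (h : ∀ (W : VField m N) (b : ℝ), DiffFieldAt W x →
      ambientForm D.γ D.ℓ D.ℓ₂ x V (W x, b) = ambientForm D.γ D.ℓ D.ℓ₂ x V' (W x, b)) :
    V = V' := by
  refine D.ambientForm_ext fun Y ↦ ?_
  obtain ⟨W, hW, hWx⟩ := exists_diffFieldAt_eq Y.1
  simpa [hWx] using! h W Y.2 hW

lemma koszulPair_add_left (hX : DiffFieldAt X x) (hX' : DiffFieldAt X' x) (hZ : DiffFieldAt Z x) :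
    D.koszulPair (X + X') Z x = D.koszulPair X Z x + D.koszulPair X' Z x := by
  refine D.ambientForm_ext_field fun W b hW ↦ ?_
  rw [map_add, LinearMap.add_apply, D.ambientForm_koszulPair hX hZ hW,
    D.ambientForm_koszulPair hX' hZ hW, D.ambientForm_koszulPair (hX.add hX') hZ hW,
    koszul_add_left D.smooth_γ hX hX' hZ hW, koszul₁_add_left D.smooth_ℓ hX hX']
  ring

lemma koszulPair_smul_left (hf : DiffFunAt (m := m) f x) (hX : DiffFieldAt X x)
    (hZ : DiffFieldAt Z x) :
    D.koszulPair (f • X) Z x = f x • D.koszulPair X Z x := by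
  refine D.ambientForm_ext_field fun W b hW ↦ ?_
  rw [map_smul, LinearMap.smul_apply, D.ambientForm_koszulPair hX hZ hW,
    D.ambientForm_koszulPair (hX.smul hf) hZ hW,
    koszul_smul_left D.smooth_γ hf hX hZ hW, koszul₁_smul_left D.smooth_ℓ hf hX, smul_eq_mul]
  ring

lemma koszulPair_add_right (hX : DiffFieldAt X x) (hZ : DiffFieldAt Z x)
    (hZ' : DiffFieldAt Z' x) :
    D.koszulPair X (Z + Z') x = D.koszulPair X Z x + D.koszulPair X Z' x := by
  refine D.ambientForm_ext_field fun W b hW ↦ ?_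
  rw [map_add, LinearMap.add_apply, D.ambientForm_koszulPair hX hZ hW,
    D.ambientForm_koszulPair hX hZ' hW, D.ambientForm_koszulPair hX (hZ.add hZ') hW,
    koszul_add_mid D.smooth_γ hX hZ hZ' hW, koszul₁_add_right D.smooth_ℓ hZ hZ']
  ring

lemma koszulPair_smul_right (hf : DiffFunAt (m := m) f x) (hX : DiffFieldAt X x)
    (hZ : DiffFieldAt Z x) :
    D.koszulPair X (f • Z) x = f x • D.koszulPair X Z x + (dirDeriv X f x • Z x, 0) := by
  refine D.ambientForm_ext_field fun W b hW ↦ ?_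
  rw [map_add, map_smul, LinearMap.add_apply, LinearMap.smul_apply,
    D.ambientForm_koszulPair hX hZ hW, D.ambientForm_koszulPair hX (hZ.smul hf) hW,
    koszul_smul_mid D.smooth_γ D.symm_γ hf hX hZ hW, koszul₁_smul_right D.smooth_ℓ hf hZ,
    ambientForm_apply]
  simp only [map_smul, smul_apply, smul_eq_mul]
  ring

lemma γ_n_right (x : N) (W : TangentSpace (𝓡 m) x) : D.γ x W (D.n x) = - (D.n₂ x * D.ℓ x W) := by
  rw [D.symm_γ, D.γ_n, neg_mul]

/-- By symmetry, pairing with `(n, n⁽²⁾)` extracts the second component. In the Koszul side `γ(·, n)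
= -n⁽²⁾ℓ`, so the derivatives of `ℓ(X)`, `ℓ(Z)` and the term `ℓ([X, Z])` cancel against `koszul₁`.
What remains is `-½𝓛_nγ` and the `dn⁽²⁾` terms. -/
lemma koszulPair_snd (hX : DiffFieldAt X x) (hZ : DiffFieldAt Z x) :
    (D.koszulPair X Z x).2 = - D.U X Z x := by
  obtain ⟨hn, hn₂⟩ := D.normalPair_mdifferentiableAt x
  have h1 : ambientForm D.γ D.ℓ D.ℓ₂ x (D.koszulPair X Z x) (D.n x, D.n₂ x) =
      (D.koszulPair X Z x).2 := by
    simp only [ambientForm_apply, D.γ_n_right, D.ℓ_n]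
    ring
  rw [← h1, D.ambientForm_koszulPair hX hZ hn]
  simp only [koszul, koszul₁, U, lieDeriv₂, D.γ_n_right, dirDeriv_neg,
    dirDeriv_mul hn₂ (D.smooth_ℓ.diffFunAt_apply hX),
    dirDeriv_mul hn₂ (D.smooth_ℓ.diffFunAt_apply hZ)]
  rw [mlieBracket_swap_apply (V := X) (W := D.n), mlieBracket_swap_apply (V := Z) (W := D.n),
    D.symm_γ x (X x)]
  simp only [map_neg, neg_apply]
  ring

lemma γ_koszulPair_fst (hX : DiffFieldAt X x) (hZ : DiffFieldAt Z x) (hW : DiffFieldAt W x) :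
    D.γ x (D.koszulPair X Z x).1 (W x) =
      1 / 2 * koszul D.γ X Z W x + D.U X Z x * D.ℓ x (W x) := by
  have := D.ambientForm_koszulPair hX hZ hW 0
  simp only [ambientForm_apply, D.koszulPair_snd hX hZ] at this
  linear_combination this

lemma ℓ_koszulPair_fst (hX : DiffFieldAt X x) (hZ : DiffFieldAt Z x) :
    D.ℓ x (D.koszulPair X Z x).1 = 1 / 2 * koszul₁ D.ℓ X Z x + D.U X Z x * D.ℓ₂ x := by
  -- The test field is arbitrary; its contribution drops out between `b = 1` and `b = 0`.
  have h0 := D.ambientForm_koszulPair hX hZ hX 0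
  have h1 := D.ambientForm_koszulPair hX hZ hX 1
  simp only [ambientForm_apply, D.koszulPair_snd hX hZ] at h0 h1
  linear_combination h1 - h0

lemma tensorialAt_koszulPair_fst (hZ : DiffFieldAt Z x) :
    TensorialAt (𝓡 m) (EuclideanSpace ℝ (Fin m)) (fun X ↦ (D.koszulPair X Z x).1) x where
  smul hf hX := by rw [D.koszulPair_smul_left hf hX hZ, Prod.smul_fst]
  add hX hX' := by rw [D.koszulPair_add_left hX hX' hZ, Prod.fst_add]

open Classical in
/-- The metric hypersurface connection, defined by the Koszul formulas. -/
def connection : PreConnection m N := fun Z x ↦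
  -- The value `0` is harmless: the axioms of a covariant derivative only test fields differentiable
  -- at the point.
  if h : DiffFieldAt Z x then TensorialAt.mkHom _ x (D.tensorialAt_koszulPair_fst h) else 0

lemma connection_apply (hX : DiffFieldAt X x) (hZ : DiffFieldAt Z x) :
    D.connection Z x (X x) = (D.koszulPair X Z x).1 := by
  rw [connection, dif_pos hZ]
  exact TensorialAt.mkHom_apply (D.tensorialAt_koszulPair_fst hZ) hX

lemma isCovariantDerivativeOn_connection :
    IsCovariantDerivativeOn (EuclideanSpace ℝ (Fin m)) D.connection univ where
  add {Z Z' x} hZ hZ' _ := by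
    ext1 v
    obtain ⟨X, hX, rfl⟩ := exists_diffFieldAt_eq v
    rw [add_apply, D.connection_apply hX hZ, D.connection_apply hX hZ',
      D.connection_apply hX (DiffFieldAt.add hZ hZ'), D.koszulPair_add_right hX hZ hZ',
      Prod.fst_add]
  leibniz {Z f x} hZ hf _ := by
    ext1 v
    obtain ⟨X, hX, rfl⟩ := exists_diffFieldAt_eq v
    rw [add_apply, smul_apply, D.connection_apply hX hZ,
      D.connection_apply hX (DiffFieldAt.smul hf hZ), D.koszulPair_smul_right hf hX hZ,
      Prod.fst_add, Prod.smul_fst]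
    rfl

lemma U_symm (X Z : VField m N) (x : N) : D.U X Z x = D.U Z X x := by
  simp only [U, lieDeriv₂, fun y ↦ D.symm_γ y (Z y) (X y), D.symm_γ x (Z x),
    D.symm_γ x (mlieBracket (𝓡 m) D.n Z x)]
  ring

lemma koszulPair_fst_sub (hX : DiffFieldAt X x) (hZ : DiffFieldAt Z x) :
    (D.koszulPair X Z x).1 - (D.koszulPair Z X x).1 = mlieBracket (𝓡 m) X Z x := by
  suffices h : D.koszulPair X Z x - D.koszulPair Z X x = (mlieBracket (𝓡 m) X Z x, 0) from
    congrArg Prod.fst h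
  refine D.ambientForm_ext_field fun W b hW ↦ ?_
  rw [map_sub, LinearMap.sub_apply, D.ambientForm_koszulPair hX hZ hW,
    D.ambientForm_koszulPair hZ hX hW, ambientForm_apply]
  linear_combination 1 / 2 * koszul_sub_swap (X := X) (Z := Z) (W := W) (x := x) D.symm_γ
    + b / 2 * koszul₁_sub_swap (ℓ := D.ℓ) (X := X) (Z := Z) (x := x)

theorem isMetricHypersurfaceConnection_connection :
    D.IsMetricHypersurfaceConnection D.connection where
  isConnection := D.isCovariantDerivativeOn_connection
  torsionFree X Z hX hZ x hx := by
    replace hX := hX.diffFieldAt isOpen_univ hx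
    replace hZ := hZ.diffFieldAt isOpen_univ hx
    rw [D.connection_apply hX hZ, D.connection_apply hZ hX, D.koszulPair_fst_sub hX hZ]
  deriv_γ X Z W hX hZ hW x := by
    replace hX := hX.diffFieldAt isOpen_univ (mem_univ x)
    replace hZ := hZ.diffFieldAt isOpen_univ (mem_univ x)
    replace hW := hW.diffFieldAt isOpen_univ (mem_univ x)
    rw [covDeriv₂, D.connection_apply hX hZ, D.connection_apply hX hW, D.symm_γ x (Z x),
      D.γ_koszulPair_fst hX hZ hW, D.γ_koszulPair_fst hX hW hZ]
    linear_combination -1 / 2 * koszul_add_swap (X := X) (Z := Z) (W := W) (x := x) D.symm_γ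
  deriv_ℓ X Z hX hZ x := by
    replace hX := hX.diffFieldAt isOpen_univ (mem_univ x)
    replace hZ := hZ.diffFieldAt isOpen_univ (mem_univ x)
    rw [covDeriv₁, covDeriv₁, D.connection_apply hX hZ, D.connection_apply hZ hX,
      D.ℓ_koszulPair_fst hX hZ, D.ℓ_koszulPair_fst hZ hX, D.U_symm Z X, koszul₁, koszul₁,
      mlieBracket_swap_apply (V := Z) (W := X), map_neg]
    ring

end MetricHypersurfaceData

/-! ### Locality of the Lie derivative and the Koszul identity for a given connection -/

section Congruence

open VectorField

variable {m : ℕ} {N : Type*} [TopologicalSpace N] [ChartedSpace (EuclideanSpace ℝ (Fin m)) N]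
  {T : CovTensor₂ m N} {V V' Z Z' W W' : VField m N} {x : N}

lemma lieDeriv₂_congr (hV : ∀ᶠ y in nhds x, V y = V' y) (hZ : ∀ᶠ y in nhds x, Z y = Z' y)
    (hW : ∀ᶠ y in nhds x, W y = W' y) : lieDeriv₂ V T Z W x = lieDeriv₂ V' T Z' W' x := by
  have h : (fun y ↦ T y (Z y) (W y)) =ᶠ[nhds x] fun y ↦ T y (Z' y) (W' y) := by
    filter_upwards [hZ, hW] with y h1 h2
    rw [h1, h2]
  rw [lieDeriv₂, lieDeriv₂, dirDeriv_congr hV.self_of_nhds h,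
    Filter.EventuallyEq.mlieBracket_vectorField_eq hV hZ,
    Filter.EventuallyEq.mlieBracket_vectorField_eq hV hW, hZ.self_of_nhds, hW.self_of_nhds]

/-- The classical Koszul computation with `∇γ` left unevaluated. It serves both connections: the
left side is `0` for Levi-Civita and `-2U(X, Z)ℓ(W)` for the metric hypersurface connection. -/
lemma covDeriv₂_cyclic {γ : CovTensor₂ m N} {cov : PreConnection m N} {X : VField m N}
    (hs : ∀ (x : N) (V W : TangentSpace (𝓡 m) x), γ x V W = γ x W V)
    (hXZ : cov Z x (X x) - cov X x (Z x) = mlieBracket (𝓡 m) X Z x)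
    (hXW : cov W x (X x) - cov X x (W x) = mlieBracket (𝓡 m) X W x)
    (hZW : cov W x (Z x) - cov Z x (W x) = mlieBracket (𝓡 m) Z W x) :
    covDeriv₂ cov γ X Z W x + covDeriv₂ cov γ Z X W x - covDeriv₂ cov γ W X Z x =
      koszul γ X Z W x - 2 * γ x (cov Z x (X x)) (W x) := by
  simp only [covDeriv₂, koszul, ← hXZ, ← hXW, ← hZW, map_sub, sub_apply]
  rw [hs x (Z x) (cov W x (X x)), hs x (X x) (cov W x (Z x)), hs x (X x) (cov Z x (W x))]
  ring

variable [IsManifold (𝓡 m) ∞ N]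

lemma lieDeriv₂_smul {f : N → ℝ} (hf : DiffFunAt (m := m) f x) (hV : DiffFieldAt V x) :
    lieDeriv₂ (f • V) T Z W x = f x * lieDeriv₂ V T Z W x
      + dirDeriv Z f x * T x (V x) (W x) + dirDeriv W f x * T x (Z x) (V x) := by
  simp only [lieDeriv₂, dirDeriv_smul_left, mlieBracket_fun_smul_left hf hV, map_add, map_smul,
    add_apply, smul_apply, smul_eq_mul]
  ring

lemma IsLeviCivitaOn.koszul_eq {γ : CovTensor₂ m N} {s : Set N} {cov : PreConnection m N}
    (h : IsLeviCivitaOn γ s cov)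
    (hs : ∀ (x : N) (V W : TangentSpace (𝓡 m) x), γ x V W = γ x W V)
    {X Z W : VField m N} (hX : SmoothFieldOn X s) (hZ : SmoothFieldOn Z s)
    (hW : SmoothFieldOn W s) (hx : x ∈ s) :
    2 * γ x (cov Z x (X x)) (W x) = koszul γ X Z W x := by
  have := covDeriv₂_cyclic hs (h.torsionFree X Z hX hZ x hx) (h.torsionFree X W hX hW x hx)
    (h.torsionFree Z W hZ hW x hx)
  rw [h.metric X Z W hX hZ hW x hx, h.metric Z X W hZ hX hW x hx,
    h.metric W X Z hW hX hZ x hx] at this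
  linear_combination this

end Congruence

/-! ### Non-null points and comparison with the Levi-Civita connection -/

namespace MetricHypersurfaceData

open VectorField

variable {m : ℕ} {N : Type*} [TopologicalSpace N] [ChartedSpace (EuclideanSpace ℝ (Fin m)) N]
  [IsManifold (𝓡 m) ∞ N] (D : MetricHypersurfaceData m N)
  {X Z W : VField m N} {x : N}

variable {D} in
lemma IsMetricHypersurfaceConnection.koszul_eq {cov : PreConnection m N}
    (h : D.IsMetricHypersurfaceConnection cov) (hX : SmoothFieldOn X univ)
    (hZ : SmoothFieldOn Z univ) (hW : SmoothFieldOn W univ) :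
    2 * D.γ x (cov Z x (X x)) (W x) = koszul D.γ X Z W x + 2 * D.U X Z x * D.ℓ x (W x) := by
  have hx := mem_univ x
  have := covDeriv₂_cyclic D.symm_γ (h.torsionFree X Z hX hZ x hx) (h.torsionFree X W hX hW x hx)
    (h.torsionFree Z W hZ hW x hx)
  rw [h.deriv_γ X Z W hX hZ hW x, h.deriv_γ Z X W hZ hX hW x,
    h.deriv_γ W X Z hW hX hZ x, D.U_symm Z X, D.U_symm W X, D.U_symm W Z] at this
  linear_combination this

variable {D} in
lemma IsNonNull.γ_ℓsharp (h : D.IsNonNull x) (W : TangentSpace (𝓡 m) x) :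
    D.γ x (D.ℓsharp x) W = D.ℓ x W := by
  have : T2Space (TangentSpace (𝓡 m) x) := inferInstanceAs (T2Space (EuclideanSpace ℝ (Fin m)))
  have hd : Module.finrank ℝ (TangentSpace (𝓡 m) x) =
      Module.finrank ℝ (TangentSpace (𝓡 m) x →L[ℝ] ℝ) := by
    have := (LinearMap.toContinuousLinearMap (𝕜 := ℝ) (E := TangentSpace (𝓡 m) x)
      (F' := ℝ)).finrank_eq
    rw [← this, Subspace.dual_finrank_eq]
  have hi : Function.Injective (D.γ x).toLinearMap :=
    (injective_iff_map_eq_zero _).2 fun V hV ↦ h V fun W ↦ DFunLike.congr_fun hV W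
  have hinv : (D.γ x).IsInvertible :=
    ⟨((D.γ x).toLinearMap.linearEquivOfInjective hi hd).toContinuousLinearEquiv, rfl⟩
  rw [ℓsharp, hinv.self_apply_inverse]

variable {D} in
lemma IsNonNull.ext (h : D.IsNonNull x) {V V' : TangentSpace (𝓡 m) x}
    (hV : ∀ W, D.γ x V W = D.γ x V' W) : V = V' := by
  rw [← sub_eq_zero]
  refine h _ fun W ↦ ?_
  rw [map_sub, sub_apply, hV, sub_self]

variable {D} in
lemma IsNonNull.n_eq (h : D.IsNonNull x) : D.n x = - D.n₂ x • D.ℓsharp x := by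
  refine h.ext fun W ↦ ?_
  rw [D.γ_n, map_smul, smul_apply, h.γ_ℓsharp, smul_eq_mul]

variable {D} in
lemma IsNonNull.n₂_mul (h : D.IsNonNull x) :
    D.n₂ x * (D.ℓ₂ x - D.γ x (D.ℓsharp x) (D.ℓsharp x)) = 1 := by
  have := D.ℓ_n x
  rw [h.n_eq, map_smul, smul_eq_mul] at this
  rw [h.γ_ℓsharp]
  linear_combination this

/-- Near `x` one has `ℓ♯ = -n / n⁽²⁾`, so the differentiability of the normal pair suffices. -/
lemma diffFieldAt_ℓsharp (h : ∀ᶠ y in nhds x, D.IsNonNull y) : DiffFieldAt D.ℓsharp x := by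
  obtain ⟨hn, hn₂⟩ := D.normalPair_mdifferentiableAt x
  have hne : D.n₂ x ≠ 0 := left_ne_zero_of_mul_eq_one h.self_of_nhds.n₂_mul
  have hf : DiffFunAt (m := m) (fun y ↦ - (D.n₂ y)⁻¹) x :=
    ((differentiableAt_inv hne).neg).mdifferentiableAt.comp x hn₂
  refine (DiffFieldAt.smul hf hn).congr_of_eventuallyEq ?_
  filter_upwards [h] with y hy
  have hy0 : D.n₂ y ≠ 0 := left_ne_zero_of_mul_eq_one hy.n₂_mul
  rw [Pi.smul_apply', hy.n_eq, smul_smul, neg_mul_neg, inv_mul_cancel₀ hy0, one_smul]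

/-- In `𝓛_n γ` with `n = -n⁽²⁾ℓ♯`, differentiating the factor gives `-(dn⁽²⁾ ⊗ ℓ + ℓ ⊗ dn⁽²⁾)`,
exactly what the second part of `U` compensates. -/
lemma U_eq_lieDeriv₂_ℓsharp (h : ∀ᶠ y in nhds x, D.IsNonNull y) :
    D.U X Z x = - (D.n₂ x / 2) * lieDeriv₂ D.ℓsharp D.γ X Z x := by
  obtain ⟨-, hn₂⟩ := D.normalPair_mdifferentiableAt x
  have hne : DiffFunAt (m := m) (fun y ↦ - D.n₂ y) x := hn₂.neg
  have hn : ∀ᶠ y in nhds x, D.n y = ((fun y ↦ - D.n₂ y) • D.ℓsharp) y := by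
    filter_upwards [h] with y hy using hy.n_eq
  rw [U, lieDeriv₂_congr hn (.of_forall fun _ ↦ rfl) (.of_forall fun _ ↦ rfl),
    lieDeriv₂_smul hne (D.diffFieldAt_ℓsharp h), dirDeriv_neg, dirDeriv_neg, D.symm_γ x (X x),
    h.self_of_nhds.γ_ℓsharp, h.self_of_nhds.γ_ℓsharp]
  ring

/-- The difference between the Levi-Civita connection and the metric hypersurface connection. -/
def leviCivitaCorrection (x : N) :
    TangentSpace (𝓡 m) x →L[ℝ] TangentSpace (𝓡 m) x →L[ℝ] TangentSpace (𝓡 m) x :=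
  TensorialAt.mkHom₂ (I := 𝓡 m) (F := EuclideanSpace ℝ (Fin m)) (F' := EuclideanSpace ℝ (Fin m))
    -- This is `-U(X, Z)ℓ♯`. In this form tensoriality in `Z` is immediate, because the Leibniz term
    -- of `koszulPair_smul_right` has second component `0`.
    (fun Z X ↦ (D.koszulPair X Z x).2 • D.ℓsharp x) x
    (fun X hX ↦
      { smul := fun hf hZ ↦ by
          simp [D.koszulPair_smul_right hf hX hZ, mul_smul]
        add := fun hZ hZ' ↦ by
          simp [D.koszulPair_add_right hX hZ hZ', add_smul] })
    (fun Z hZ ↦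
      { smul := fun hf hX ↦ by
          simp [D.koszulPair_smul_left hf hX hZ, mul_smul]
        add := fun hX hX' ↦ by
          simp [D.koszulPair_add_left hX hX' hZ, add_smul] })

/-- The Levi-Civita connection of `γ` on the set of non-null points. -/
def leviCivita : PreConnection m N := fun Z x ↦ D.connection Z x + D.leviCivitaCorrection x (Z x)

lemma leviCivita_apply (hX : DiffFieldAt X x) (hZ : DiffFieldAt Z x) :
    D.leviCivita Z x (X x) =
      (D.koszulPair X Z x).1 + (D.koszulPair X Z x).2 • D.ℓsharp x := by
  rw [leviCivita, add_apply, D.connection_apply hX hZ, leviCivitaCorrection,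
    TensorialAt.mkHom₂_apply _ _ hZ hX]

lemma γ_leviCivita (h : D.IsNonNull x) (hX : DiffFieldAt X x) (hZ : DiffFieldAt Z x)
    (hW : DiffFieldAt W x) :
    D.γ x (D.leviCivita Z x (X x)) (W x) = 1 / 2 * koszul D.γ X Z W x := by
  rw [D.leviCivita_apply hX hZ, map_add, map_smul, add_apply, smul_apply,
    D.γ_koszulPair_fst hX hZ hW, D.koszulPair_snd hX hZ, h.γ_ℓsharp, smul_eq_mul]
  ring

/-- Subtracting `U ⊗ ℓ♯` preserves torsion-freeness because `U` is symmetric, and removes the `Uℓ`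
term from the Koszul formula because `γ(ℓ♯, ·) = ℓ`. -/
theorem isLeviCivitaOn_leviCivita {s : Set N} (hs : IsOpen s) (h : ∀ x ∈ s, D.IsNonNull x) :
    IsLeviCivitaOn D.γ s D.leviCivita where
  isConnection :=
    (D.isCovariantDerivativeOn_connection.mono (subset_univ s)).add_one_form _
  torsionFree X Z hX hZ x hx := by
    replace hX := hX.diffFieldAt hs hx
    replace hZ := hZ.diffFieldAt hs hx
    rw [D.leviCivita_apply hX hZ, D.leviCivita_apply hZ hX, ← D.koszulPair_fst_sub hX hZ,
      D.koszulPair_snd hX hZ, D.koszulPair_snd hZ hX, D.U_symm Z X]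
    abel
  metric X Z W hX hZ hW x hx := by
    replace hX := hX.diffFieldAt hs hx
    replace hZ := hZ.diffFieldAt hs hx
    replace hW := hW.diffFieldAt hs hx
    rw [covDeriv₂, D.symm_γ x (Z x), D.γ_leviCivita (h x hx) hX hZ hW,
      D.γ_leviCivita (h x hx) hX hW hZ]
    linear_combination -1 / 2 * koszul_add_swap (X := X) (Z := Z) (W := W) (x := x) D.symm_γ

variable {D} in
/-- At non-null points the metric hypersurface connection is the Levi-Civita connection of `γ`
plus `U ⊗ ℓ♯`, on globally smooth vector fields. -/
lemma IsMetricHypersurfaceConnection.eq_leviCivita_add [T2Space N] {s : Set N}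
    {nablaO nablaγ : PreConnection m N} (hO : D.IsMetricHypersurfaceConnection nablaO)
    (hγ : IsLeviCivitaOn D.γ s nablaγ) (hX : SmoothFieldOn X univ) (hZ : SmoothFieldOn Z univ)
    (hx : x ∈ s) (h : D.IsNonNull x) :
    nablaO Z x (X x) = nablaγ Z x (X x) + D.U X Z x • D.ℓsharp x := by
  refine h.ext fun V ↦ ?_
  obtain ⟨W, hW, rfl⟩ := exists_smoothField_eq V
  rw [map_add, map_smul, add_apply, smul_apply, h.γ_ℓsharp, smul_eq_mul]
  linear_combination 1 / 2 * hO.koszul_eq (x := x) hX hZ hW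
    - 1 / 2 * hγ.koszul_eq D.symm_γ (hX.mono (subset_univ s)) (hZ.mono (subset_univ s))
      (hW.mono (subset_univ s)) hx

end MetricHypersurfaceData

end HypersurfaceData

end

theorem mainTheorem9 {m : ℕ} {N : Type*} [TopologicalSpace N] [T2Space N]
    [SecondCountableTopology N] [ConnectedSpace N]
    [ChartedSpace (EuclideanSpace ℝ (Fin m)) N] [IsManifold (𝓡 m) ∞ N]
    (D : HypersurfaceData.MetricHypersurfaceData m N)
    (p : N) (hp : D.IsNonNull p)
    (Up : Set N) (hUp : IsOpen Up) (hpU : p ∈ Up) (hγ : ∀ x ∈ Up, D.IsNonNull x) :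
    (∃ nablaO : HypersurfaceData.PreConnection m N, D.IsMetricHypersurfaceConnection nablaO) ∧
    (∃ nablaγ : HypersurfaceData.PreConnection m N,
      HypersurfaceData.IsLeviCivitaOn D.γ Up nablaγ) ∧
    (∀ x ∈ Up, D.ℓ₂ x - D.γ x (D.ℓsharp x) (D.ℓsharp x) ≠ 0) ∧
    ∀ nablaO nablaγ : HypersurfaceData.PreConnection m N,
      D.IsMetricHypersurfaceConnection nablaO →
      HypersurfaceData.IsLeviCivitaOn D.γ Up nablaγ →
      ∀ X Z : HypersurfaceData.VField m N,
        HypersurfaceData.SmoothFieldOn X Up → HypersurfaceData.SmoothFieldOn Z Up →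
        ∀ x ∈ Up,
          nablaO Z x (X x) = nablaγ Z x (X x)
            - (1 / (2 * (D.ℓ₂ x - D.γ x (D.ℓsharp x) (D.ℓsharp x)))
                * HypersurfaceData.lieDeriv₂ D.ℓsharp D.γ X Z x) • D.ℓsharp x := by
  refine ⟨⟨_, D.isMetricHypersurfaceConnection_connection⟩,
    ⟨_, D.isLeviCivitaOn_leviCivita hUp hγ⟩,
    fun x hx ↦ right_ne_zero_of_mul_eq_one (hγ x hx).n₂_mul, ?_⟩
  intro nablaO nablaγ hO hLC X Z hX hZ x hx
  -- The equations for `nablaO` are only available on globally smooth fields, so `X` and `Z` are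
  -- replaced by global fields with the same germ at `x`; both connections are local.
  obtain ⟨X', hX', hXX'⟩ := hX.exists_global hUp hx
  obtain ⟨Z', hZ', hZZ'⟩ := hZ.exists_global hUp hx
  have hn : ∀ᶠ y in nhds x, D.IsNonNull y := by
    filter_upwards [hUp.mem_nhds hx] with y hy using hγ y hy
  have hdZ := hZ.diffFieldAt hUp hx
  have hdZ' := hZ'.diffFieldAt isOpen_univ (mem_univ x)
  have h1 : nablaO Z x = nablaO Z' x :=
    hO.isConnection.congr_of_eventuallyEq hdZ hdZ' Filter.univ_mem
      (hZZ'.mono fun _ h ↦ h.symm)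
  have h2 : nablaγ Z x = nablaγ Z' x :=
    hLC.isConnection.congr_of_eventuallyEq hdZ hdZ' (hUp.mem_nhds hx)
      (hZZ'.mono fun _ h ↦ h.symm)
  rw [h1, h2, ← hXX'.self_of_nhds, hO.eq_leviCivita_add hLC hX' hZ' hx (hγ x hx),
    D.U_eq_lieDeriv₂_ℓsharp hn,
    HypersurfaceData.lieDeriv₂_congr (.of_forall fun _ ↦ rfl) hXX' hZZ', sub_eq_add_neg,
    ← neg_smul]
  congr 2
  -- The reciprocal of `ℓ⁽²⁾ - γ(ℓ♯, ℓ♯)` is `n⁽²⁾`.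
  rw [one_div, mul_inv, ← eq_inv_of_mul_eq_one_left (hγ x hx).n₂_mul]
  ring
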